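/- Let $N\ge 0$ be an integer and let $G$ be a random matrix whose law is the Haar probability measure on the group $U(N)$ of unitary $N\times N$ complex matrices. Let $\theta_1,\dots,\theta_N,\beta_{1,0},\dots,\beta_{1,N-1}$ be (jointly) independent real random variables, possibly on another probability space, such that each $\theta_k$ ($1\le k\le N$) is uniformly distributed on $(0,2\pi)$, each $\beta_{1,j}$ with $1\le j\le N-1$ has the beta distribution with parameters $1$ and $j$, and $\beta_{1,0}$ has the Dirac distribution at $1$. Then $$\det(\mathrm{Id}_N-G)\overset{\text{law}}{=}\prod_{k=1}^N\left(1-e^{\mathrm{i}\theta_k}\sqrt{\beta_{1,k-1}}\right),$$ that is, the two sides have the same distribution as complex random variables. -/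

import Mathlib

open MeasureTheory ProbabilityTheory

/-- The law of `β_{1,j}`: the beta distribution with parameters `1` and `j` for `j ≥ 1`, and the
Dirac mass at `1` for `j = 0`. -/
noncomputable def betaOneLaw (j : ℕ) : Measure ℝ :=
  if j = 0 then Measure.dirac 1 else betaMeasure 1 (j : ℝ)

/-!
The proof peels off one factor at a time. Write a Haar matrix of `U(n+1)` as `G`, let `G₀₀` be one
of its diagonal entries, and embed `H ∈ U(n)` into `U(n+1)` as `1 ⊕ H`. Taking the Schur complement
of the entry `1 - G₀₀` in `1 - G (1 ⊕ H)` gives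
`det (1 - G (1 ⊕ H)) = (1 - G₀₀) det (1 - K H)`,
where `K` depends on `G` only and, because `G` is unitary, is itself unitary
(`exists_unitary_schurComplement`). For each `H`, right invariance of the Haar measure of `U(n+1)`
says that `G (1 ⊕ H)` has the law of `G`; for each `G`, left invariance of the Haar measure of
`U(n)` removes `K`. By Fubini, `det (1 - G)` has the law of `(1 - G₀₀) det (1 - H)` with `H` Haar on
`U(n)` and independent of `G` (`haar_map_det_one_sub_succ`), so that its law is a multiplicative
convolution.

It remains to find the law of the entry `G₀₀`. Multiplying `G` by scalars of modulus one shows that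
it is rotation invariant, so only the law of `|G₀₀|²` matters (`haar_map_one_sub_entry`). By right
invariance `G₀₀` has the law of `(G z)₀ / ‖z‖` for every `z ≠ 0`. Averaging over `z` with the
Gaussian weight `exp (-‖z‖²)` on `ℂⁿ⁺¹`, which is invariant under unitary maps, turns
`P (|G₀₀|² > t)` into the proportion of the weight carried by `{|z₀|² > t ‖z‖²}`. For `0 ≤ t < 1`
this is `{|z₀|² > t / (1 - t) * ∑_{j ≠ 0} |z_j|²}`, and since
`∫_{|z|² > y} exp (-|z|²) = π exp (-y)`, the proportion is `(1 - t) ^ n`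
(`gaussianWeight_setOf_lt_norm_sq`). That is the tail of the beta distribution with parameters `1`
and `n`, and of the Dirac mass at `1` if `n = 0` (`betaOneLaw_Ioi_of_lt_one`).
-/

/-! ### The Schur complement of a diagonal entry of a unitary matrix -/

section UnitaryAlgebra

variable {ι : Type*} [Fintype ι] [DecidableEq ι]

open Matrix ComplexOrder in
/-- For a unitary block matrix `G` with scalar corner `a ≠ 1`, the matrix `K = d + (1 - a)⁻¹ c b` is
unitary, and the Schur complement of `1 - a` in `1 - G (1 ⊕ H)` is `1 - K H`. If `a = 1`, then
unitarity forces `c = 0`, both sides vanish, and `K = 1` serves. -/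
theorem exists_unitary_schurComplement {a : Matrix Unit Unit ℂ} {b : Matrix Unit ι ℂ}
    {c : Matrix ι Unit ℂ} {d : Matrix ι ι ℂ}
    (hG : fromBlocks a b c d ∈ unitaryGroup (Unit ⊕ ι) ℂ) :
    ∃ K ∈ unitaryGroup ι ℂ, ∀ H : Matrix ι ι ℂ,
      det (1 - fromBlocks a b c d * fromBlocks 1 0 0 H) = (1 - a () ()) * det (1 - K * H) := by
  have hblock (H : Matrix ι ι ℂ) : 1 - fromBlocks a b c d * fromBlocks 1 0 0 H =
      fromBlocks (1 - a) (-(b * H)) (-c) (1 - d * H) := by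
    rw [fromBlocks_multiply, ← fromBlocks_one, sub_eq_add_neg, fromBlocks_neg, fromBlocks_add]
    simp [sub_eq_add_neg]
  have hstar := mem_unitaryGroup_iff'.1 hG
  rw [star_eq_conjTranspose, fromBlocks_conjTranspose, fromBlocks_multiply, ← fromBlocks_one,
    fromBlocks_inj] at hstar
  obtain ⟨h11, h12, h21, h22⟩ := hstar
  have ha : a = a () () • (1 : Matrix Unit Unit ℂ) := by ext ⟨⟩ ⟨⟩; simp
  generalize a () () = z at ha
  subst ha
  by_cases hz : z = 1
  · subst hz
    have hc : c = 0 := by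
      rw [← conjTranspose_mul_self_eq_zero]
      simpa using h11
    refine ⟨1, one_mem _, fun H ↦ ?_⟩
    rw [hblock, hc]
    simp
  · have hz1 : 1 - z ≠ 0 := sub_ne_zero.2 (Ne.symm hz)
    have hz2 : 1 - star z ≠ 0 := by
      have := (star_ne_zero (R := ℂ)).2 hz1
      simpa using this
    refine ⟨d + (1 - z)⁻¹ • (c * b), ?_, fun H ↦ ?_⟩
    · -- the blocks of `Gᴴ G = 1` express `Kᴴ K` as `1` plus a scalar multiple of `bᴴ b`
      have hcd : cᴴ * d = -(star z • b) := by
        rw [eq_neg_iff_add_eq_zero, add_comm]; simpa using h12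
      have hdc : dᴴ * c = -(z • bᴴ) := by
        rw [eq_neg_iff_add_eq_zero, add_comm]; simpa using h21
      have hcc : cᴴ * c = (1 - star z * z) • (1 : Matrix Unit Unit ℂ) := by
        rw [sub_smul, one_smul, eq_sub_iff_add_eq, add_comm]
        simpa [smul_smul, mul_comm] using h11
      have hdd : dᴴ * d = 1 - bᴴ * b := by
        rw [eq_sub_iff_add_eq, add_comm]; exact h22
      rw [mem_unitaryGroup_iff', star_eq_conjTranspose, conjTranspose_add, conjTranspose_smul,
        conjTranspose_mul, add_mul, mul_add, mul_add, Matrix.mul_smul, ← Matrix.mul_assoc, hdc, hdd,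
        Matrix.smul_mul, Matrix.mul_assoc, hcd, Matrix.smul_mul, Matrix.mul_smul, Matrix.mul_assoc,
        ← Matrix.mul_assoc cᴴ, hcc]
      simp only [Matrix.neg_mul, Matrix.mul_neg, Matrix.smul_mul, Matrix.mul_smul, Matrix.one_mul,
        smul_neg, smul_smul]
      have key : -((1 - z)⁻¹ * z) - star (1 - z)⁻¹ * star z
          + star (1 - z)⁻¹ * (1 - z)⁻¹ * (1 - star z * z) = 1 := by
        rw [star_inv₀, star_sub, star_one]
        field_simp
        ring
      have : (1 : Matrix ι ι ℂ) + (-1 + (-((1 - z)⁻¹ * z) - star (1 - z)⁻¹ * star z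
          + star (1 - z)⁻¹ * (1 - z)⁻¹ * (1 - star z * z))) • (bᴴ * b) = 1 := by
        rw [key]; simp
      refine Eq.trans ?_ this
      module
    · have h1 : (1 : Matrix Unit Unit ℂ) - z • 1 = (1 - z) • 1 := by rw [sub_smul, one_smul]
      let _ : Invertible ((1 - z) • (1 : Matrix Unit Unit ℂ)) :=
        ⟨(1 - z)⁻¹ • 1, by simp [smul_smul, hz1], by simp [smul_smul, hz1]⟩
      have hinv : ⅟((1 - z) • (1 : Matrix Unit Unit ℂ)) = (1 - z)⁻¹ • 1 := rfl
      rw [hblock, h1, det_fromBlocks₁₁, hinv]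
      congr 1
      · simp
      · congr 1
        simp only [Matrix.neg_mul, Matrix.mul_neg, Matrix.smul_mul, Matrix.mul_smul, Matrix.mul_one,
          smul_neg, add_mul, Matrix.mul_assoc]
        abel

end UnitaryAlgebra

/-! ### Haar measure on the unitary group -/

section UnitaryGroup

variable {ι : Type*} [Fintype ι] [DecidableEq ι]

theorem isCompact_unitaryGroup :
    IsCompact (Matrix.unitaryGroup ι ℂ : Set (Matrix ι ι ℂ)) := by
  have hbox : IsCompact (Set.univ.pi fun _ : ι ↦ Set.univ.pi fun _ : ι ↦
      Metric.closedBall (0 : ℂ) 1) :=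
    isCompact_univ_pi fun _ ↦ isCompact_univ_pi fun _ ↦ isCompact_closedBall _ _
  refine IsCompact.of_isClosed_subset (X := Matrix ι ι ℂ) hbox ?_ fun U hU ↦ ?_
  · have : (Matrix.unitaryGroup ι ℂ : Set (Matrix ι ι ℂ)) = {U | star U * U = 1} := by
      ext U
      exact Matrix.mem_unitaryGroup_iff'
    rw [this]
    exact isClosed_eq (by fun_prop) continuous_const
  · intro i _ j _
    exact mem_closedBall_zero_iff.2 (entry_norm_bound_of_unitary hU i j)

instance : CompactSpace (Matrix.unitaryGroup ι ℂ) :=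
  isCompact_iff_compactSpace.1 isCompact_unitaryGroup

/-- Compact groups are unimodular: a right translate of the Haar probability measure is again a Haar
probability measure, hence the same. -/
theorem isMulRightInvariant_of_isHaarMeasure {G : Type*} [Group G] [TopologicalSpace G]
    [IsTopologicalGroup G] [CompactSpace G] [MeasurableSpace G] [BorelSpace G]
    (μ : Measure G) [μ.IsHaarMeasure] [IsProbabilityMeasure μ] : μ.IsMulRightInvariant where
  map_mul_right_eq_self g := by
    have : IsProbabilityMeasure (μ.map (· * g)) :=
      Measure.isProbabilityMeasure_map (by fun_prop)
    exact Measure.isHaarMeasure_eq_of_isProbabilityMeasure _ _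

theorem exists_isHaarMeasure_isProbabilityMeasure (G : Type*) [Group G] [TopologicalSpace G]
    [IsTopologicalGroup G] [CompactSpace G] [MeasurableSpace G] [BorelSpace G] :
    ∃ μ : Measure G, μ.IsHaarMeasure ∧ IsProbabilityMeasure μ :=
  ⟨Measure.haarMeasure ⊤, inferInstance, ⟨Measure.haarMeasure_self (K₀ := ⊤)⟩⟩

@[fun_prop]
theorem measurable_unitaryGroup_entry [MeasurableSpace (Matrix.unitaryGroup ι ℂ)]
    [BorelSpace (Matrix.unitaryGroup ι ℂ)] (i j : ι) :
    Measurable fun G : Matrix.unitaryGroup ι ℂ ↦ (G : Matrix ι ι ℂ) i j := by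
  have : Continuous fun G : Matrix.unitaryGroup ι ℂ ↦ (G : Matrix ι ι ℂ) i j :=
    continuous_subtype_val.matrix_elem i j
  exact this.measurable

theorem measurable_det_of_entries {α : Type*} [MeasurableSpace α] {M : α → Matrix ι ι ℂ}
    (hM : ∀ i j, Measurable fun x ↦ M x i j) : Measurable fun x ↦ (M x).det := by
  simp only [Matrix.det_apply]
  fun_prop

end UnitaryGroup

/-! ### The Gaussian weight on `ℂⁿ` -/

open Set in
theorem lintegral_exp_neg_mul_norm_sq_of_lt {a y : ℝ} (ha : 0 < a) (hy : 0 ≤ y) :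
    ∫⁻ z in {z : ℂ | y < ‖z‖ ^ 2}, ENNReal.ofReal (Real.exp (-a * ‖z‖ ^ 2)) =
      ENNReal.ofReal (Real.pi / a * Real.exp (-a * y)) := by
  have hmeas : MeasurableSet {z : ℂ | y < ‖z‖ ^ 2} := measurableSet_lt (by fun_prop) (by fun_prop)
  -- the radial integral
  have hderiv (x : ℝ) : HasDerivAt (fun r : ℝ ↦ -(2 * a)⁻¹ * Real.exp (-a * r ^ 2))
      (x * Real.exp (-a * x ^ 2)) x := by
    have h := (((hasDerivAt_pow 2 x).const_mul (-a)).exp).const_mul (-(2 * a)⁻¹)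
    refine h.congr_deriv ?_
    field_simp
    norm_num
  have htend : Filter.Tendsto (fun r : ℝ ↦ -(2 * a)⁻¹ * Real.exp (-a * r ^ 2)) Filter.atTop
      (nhds 0) := by
    have : Filter.Tendsto (fun r : ℝ ↦ -a * r ^ 2) Filter.atTop Filter.atBot :=
      (Filter.tendsto_pow_atTop two_ne_zero).const_mul_atTop_of_neg (neg_neg_of_pos ha)
    simpa using (Real.tendsto_exp_atBot.comp this).const_mul (-(2 * a)⁻¹)
  have hradial : ∫⁻ r in Ioi √y, ENNReal.ofReal (r * Real.exp (-a * r ^ 2)) =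
      ENNReal.ofReal ((2 * a)⁻¹ * Real.exp (-a * y)) := by
    have hpos : ∀ x ∈ Ioi √y, 0 ≤ x * Real.exp (-a * x ^ 2) := fun x hx ↦
      mul_nonneg ((Real.sqrt_nonneg y).trans hx.out.le) (Real.exp_pos _).le
    have hint := integrableOn_Ioi_deriv_of_nonneg' (fun x _ ↦ hderiv x) hpos htend
    rw [← ofReal_integral_eq_lintegral_ofReal hint ((ae_restrict_iff' measurableSet_Ioi).2
      (.of_forall hpos)), integral_Ioi_of_hasDerivAt_of_tendsto' (fun x _ ↦ hderiv x) hint htend]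
    simp [Real.sq_sqrt hy]
  have hset : Ioi √y ⊆ Ioi 0 := Ioi_subset_Ioi (Real.sqrt_nonneg y)
  rw [← lintegral_indicator hmeas, ← Complex.lintegral_comp_polarCoord_symm]
  have hcongr : ∀ p ∈ polarCoord.target,
      ENNReal.ofReal p.1 • {z : ℂ | y < ‖z‖ ^ 2}.indicator
        (fun z ↦ ENNReal.ofReal (Real.exp (-a * ‖z‖ ^ 2))) (Complex.polarCoord.symm p) =
      (Ioi √y).indicator (fun r ↦ ENNReal.ofReal (r * Real.exp (-a * r ^ 2))) p.1 * 1 := by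
    intro p hp
    have hp0 : 0 < p.1 := by simpa using hp.1
    have hiff : Complex.polarCoord.symm p ∈ {z : ℂ | y < ‖z‖ ^ 2} ↔ p.1 ∈ Ioi √y := by
      rw [mem_ofPred_eq, Complex.norm_polarCoord_symm, abs_of_pos hp0, mem_Ioi, Real.sqrt_lt' hp0]
    by_cases h : p.1 ∈ Ioi √y
    · rw [indicator_of_mem h, indicator_of_mem (hiff.2 h), ENNReal.ofReal_mul hp0.le,
        Complex.norm_polarCoord_symm, abs_of_pos hp0, smul_eq_mul, mul_one]
    · rw [indicator_of_notMem h, indicator_of_notMem (mt hiff.1 h), smul_zero, zero_mul]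
  rw [setLIntegral_congr_fun polarCoord.open_target.measurableSet hcongr, polarCoord_target,
    Measure.volume_eq_prod, ← Measure.prod_restrict, lintegral_prod_mul
      (f := (Ioi √y).indicator fun r ↦ ENNReal.ofReal (r * Real.exp (-a * r ^ 2)))
      (g := fun _ ↦ 1) (Measurable.aemeasurable (Measurable.indicator (by fun_prop)
        measurableSet_Ioi)) (by fun_prop),
    lintegral_indicator measurableSet_Ioi, Measure.restrict_restrict measurableSet_Ioi,
    inter_eq_left.2 hset, hradial, lintegral_one, Measure.restrict_apply_univ, Real.volume_Ioo,
    ← ENNReal.ofReal_mul (by positivity)]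
  congr 1
  field_simp
  ring

theorem lintegral_exp_neg_mul_norm_sq {a : ℝ} (ha : 0 < a) :
    ∫⁻ z : ℂ, ENNReal.ofReal (Real.exp (-a * ‖z‖ ^ 2)) = ENNReal.ofReal (Real.pi / a) := by
  have h := lintegral_exp_neg_mul_norm_sq_of_lt ha le_rfl
  have hset : {z : ℂ | (0 : ℝ) < ‖z‖ ^ 2} =ᵐ[volume] (Set.univ : Set ℂ) := by
    have : {z : ℂ | (0 : ℝ) < ‖z‖ ^ 2} = {0}ᶜ := by ext z; simp [sq_pos_iff]
    rw [this, ae_eq_univ, compl_compl]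
    exact measure_singleton 0
  rwa [setLIntegral_congr hset, setLIntegral_univ, mul_zero, Real.exp_zero, mul_one] at h

theorem lintegral_pi_exp_neg_mul_norm_sq {a : ℝ} (ha : 0 < a) (n : ℕ) :
    ∫⁻ w : Fin n → ℂ, ENNReal.ofReal (Real.exp (-a * ∑ j, ‖w j‖ ^ 2)) =
      ENNReal.ofReal ((Real.pi / a) ^ n) := by
  induction n with
  | zero => simp [lintegral_unique, volume_pi]
  | succ n ih =>
    have hsplit (w : Fin (n + 1) → ℂ) :
        ENNReal.ofReal (Real.exp (-a * ∑ j, ‖w j‖ ^ 2)) =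
          ENNReal.ofReal
            (Real.exp (-a * ‖(MeasurableEquiv.piFinSuccAbove (fun _ ↦ ℂ) 0 w).1‖ ^ 2)) *
          ENNReal.ofReal (Real.exp (-a * ∑ j,
            ‖(MeasurableEquiv.piFinSuccAbove (fun _ ↦ ℂ) 0 w).2 j‖ ^ 2)) := by
      rw [← ENNReal.ofReal_mul (Real.exp_pos _).le, ← Real.exp_add, Fin.sum_univ_succ, mul_add]
      rfl
    simp_rw [hsplit]
    rw [(volume_preserving_piFinSuccAbove (fun _ : Fin (n + 1) ↦ ℂ) 0).lintegral_comp_emb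
      (MeasurableEquiv.measurableEmbedding _) (fun p : ℂ × (Fin n → ℂ) ↦
        ENNReal.ofReal (Real.exp (-a * ‖p.1‖ ^ 2)) *
          ENNReal.ofReal (Real.exp (-a * ∑ j, ‖p.2 j‖ ^ 2))), Measure.volume_eq_prod,
      lintegral_prod_mul (f := fun z : ℂ ↦ ENNReal.ofReal (Real.exp (-a * ‖z‖ ^ 2)))
        (g := fun w : Fin n → ℂ ↦ ENNReal.ofReal (Real.exp (-a * ∑ j, ‖w j‖ ^ 2)))
        (by fun_prop) (Measurable.aemeasurable (by fun_prop)), ih, lintegral_exp_neg_mul_norm_sq ha,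
      ← ENNReal.ofReal_mul (by positivity), pow_succ']

/-- The rotation invariant Gaussian measure with density `exp (-‖z‖²)` on `ℂⁿ`. It is not
normalised: its total mass is `π ^ n`. -/
noncomputable def gaussianWeight (ι : Type*) [Fintype ι] : Measure (ι → ℂ) :=
  volume.withDensity fun z ↦ ENNReal.ofReal (Real.exp (-∑ j, ‖z j‖ ^ 2))

theorem gaussianWeight_univ (n : ℕ) :
    gaussianWeight (Fin n) Set.univ = ENNReal.ofReal (Real.pi ^ n) := by
  have := lintegral_pi_exp_neg_mul_norm_sq one_pos n
  simpa [gaussianWeight, withDensity_apply] using this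

/-- Under the normalised Gaussian weight, `|z_i|² / ‖z‖²` exceeds `t` with probability
`(1 - t) ^ n`: given the other coordinates `w`, the event is `|z_i|² > t / (1 - t) * ‖w‖²`, which
has conditional probability `exp (-t / (1 - t) * ‖w‖²)`. -/
theorem gaussianWeight_setOf_lt_norm_sq {n : ℕ} (i : Fin (n + 1)) {t : ℝ} (ht0 : 0 ≤ t)
    (ht1 : t < 1) :
    gaussianWeight (Fin (n + 1)) {z | t * ∑ j, ‖z j‖ ^ 2 < ‖z i‖ ^ 2} =
      ENNReal.ofReal ((1 - t) ^ n) * gaussianWeight (Fin (n + 1)) Set.univ := by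
  have ht : 0 < 1 - t := sub_pos.2 ht1
  have hmeas : MeasurableSet {z : Fin (n + 1) → ℂ | t * ∑ j, ‖z j‖ ^ 2 < ‖z i‖ ^ 2} :=
    measurableSet_lt (by fun_prop) (by fun_prop)
  have hmeas' : MeasurableSet {p : ℂ × (Fin n → ℂ) |
      t / (1 - t) * ∑ j, ‖p.2 j‖ ^ 2 < ‖p.1‖ ^ 2} :=
    measurableSet_lt (by fun_prop) (by fun_prop)
  have hF : Measurable ({p : ℂ × (Fin n → ℂ) | t / (1 - t) * ∑ j, ‖p.2 j‖ ^ 2 < ‖p.1‖ ^ 2}.indicator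
      fun p ↦ ENNReal.ofReal (Real.exp (-1 * ‖p.1‖ ^ 2)) *
          ENNReal.ofReal (Real.exp (-∑ j, ‖p.2 j‖ ^ 2))) :=
    Measurable.indicator (by fun_prop) hmeas'
  have hsplit (w : Fin (n + 1) → ℂ) :
      {z : Fin (n + 1) → ℂ | t * ∑ j, ‖z j‖ ^ 2 < ‖z i‖ ^ 2}.indicator
        (fun z ↦ ENNReal.ofReal (Real.exp (-∑ j, ‖z j‖ ^ 2))) w =
      {p : ℂ × (Fin n → ℂ) | t / (1 - t) * ∑ j, ‖p.2 j‖ ^ 2 < ‖p.1‖ ^ 2}.indicator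
        (fun p ↦ ENNReal.ofReal (Real.exp (-1 * ‖p.1‖ ^ 2)) *
          ENNReal.ofReal (Real.exp (-∑ j, ‖p.2 j‖ ^ 2)))
        (MeasurableEquiv.piFinSuccAbove (fun _ ↦ ℂ) i w) := by
    have e1 : (MeasurableEquiv.piFinSuccAbove (fun _ ↦ ℂ) i w).1 = w i := rfl
    have e2 (j) : (MeasurableEquiv.piFinSuccAbove (fun _ ↦ ℂ) i w).2 j = w (i.succAbove j) := rfl
    have hiff : w ∈ {z : Fin (n + 1) → ℂ | t * ∑ j, ‖z j‖ ^ 2 < ‖z i‖ ^ 2} ↔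
        MeasurableEquiv.piFinSuccAbove (fun _ ↦ ℂ) i w ∈ {p : ℂ × (Fin n → ℂ) |
          t / (1 - t) * ∑ j, ‖p.2 j‖ ^ 2 < ‖p.1‖ ^ 2} := by
      simp only [Set.mem_ofPred_eq, e1, e2, Fin.sum_univ_succAbove (fun j ↦ ‖w j‖ ^ 2) i]
      rw [div_mul_eq_mul_div, div_lt_iff₀ ht]
      constructor <;> intro h <;> linarith
    by_cases h : w ∈ {z : Fin (n + 1) → ℂ | t * ∑ j, ‖z j‖ ^ 2 < ‖z i‖ ^ 2}
    · rw [Set.indicator_of_mem h, Set.indicator_of_mem (hiff.1 h),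
        ← ENNReal.ofReal_mul (Real.exp_pos _).le, ← Real.exp_add]
      simp only [e1, e2, Fin.sum_univ_succAbove (fun j ↦ ‖w j‖ ^ 2) i]
      ring_nf
    · rw [Set.indicator_of_notMem h, Set.indicator_of_notMem (mt hiff.2 h)]
  have hinner (w : Fin n → ℂ) :
      ∫⁻ z : ℂ, {p : ℂ × (Fin n → ℂ) | t / (1 - t) * ∑ j, ‖p.2 j‖ ^ 2 < ‖p.1‖ ^ 2}.indicator
        (fun p ↦ ENNReal.ofReal (Real.exp (-1 * ‖p.1‖ ^ 2)) *
          ENNReal.ofReal (Real.exp (-∑ j, ‖p.2 j‖ ^ 2))) (z, w) =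
      ENNReal.ofReal Real.pi *
        ENNReal.ofReal (Real.exp (-(1 - t)⁻¹ * ∑ j, ‖w j‖ ^ 2)) := by
    have hy : 0 ≤ t / (1 - t) * ∑ j, ‖w j‖ ^ 2 := by positivity
    have h1 (z : ℂ) : {p : ℂ × (Fin n → ℂ) |
        t / (1 - t) * ∑ j, ‖p.2 j‖ ^ 2 < ‖p.1‖ ^ 2}.indicator
        (fun p ↦ ENNReal.ofReal (Real.exp (-1 * ‖p.1‖ ^ 2)) *
          ENNReal.ofReal (Real.exp (-∑ j, ‖p.2 j‖ ^ 2))) (z, w) =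
        {z : ℂ | t / (1 - t) * ∑ j, ‖w j‖ ^ 2 < ‖z‖ ^ 2}.indicator
          (fun z ↦ ENNReal.ofReal (Real.exp (-1 * ‖z‖ ^ 2)) *
          ENNReal.ofReal (Real.exp (-∑ j, ‖w j‖ ^ 2))) z := rfl
    simp_rw [h1]
    rw [lintegral_indicator (measurableSet_lt (by fun_prop) (by fun_prop)),
      lintegral_mul_const _ (by fun_prop), lintegral_exp_neg_mul_norm_sq_of_lt one_pos hy,
      ← ENNReal.ofReal_mul (by positivity), ← ENNReal.ofReal_mul (by positivity), div_one,
      mul_assoc, ← Real.exp_add]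
    congr 3
    field_simp
    ring
  rw [gaussianWeight_univ, gaussianWeight, withDensity_apply _ hmeas, ← lintegral_indicator hmeas]
  simp_rw [hsplit]
  rw [(volume_preserving_piFinSuccAbove (fun _ : Fin (n + 1) ↦ ℂ) i).lintegral_comp_emb
      (MeasurableEquiv.measurableEmbedding _), Measure.volume_eq_prod,
      lintegral_prod_symm _ hF.aemeasurable]
  simp_rw [hinner]
  rw [lintegral_const_mul _ (by fun_prop), lintegral_pi_exp_neg_mul_norm_sq (inv_pos.2 ht),
    ← ENNReal.ofReal_mul (by positivity), ← ENNReal.ofReal_mul (by positivity)]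
  congr 1
  rw [div_inv_eq_mul, mul_pow, pow_succ]
  ring

section UnitaryInvariance

open Matrix

theorem sum_norm_sq_mulVec {ι : Type*} [Fintype ι] [DecidableEq ι] (U : unitaryGroup ι ℂ)
    (z : ι → ℂ) : ∑ j, ‖(U.1 *ᵥ z) j‖ ^ 2 = ∑ j, ‖z j‖ ^ 2 := by
  have hsum (v : ι → ℂ) : ((∑ j, ‖v j‖ ^ 2 : ℝ) : ℂ) = star v ⬝ᵥ v := by
    simp [dotProduct, Complex.conj_mul']
  have h : star (U.1 *ᵥ z) ⬝ᵥ (U.1 *ᵥ z) = star z ⬝ᵥ z := by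
    rw [star_mulVec, dotProduct_mulVec, vecMul_vecMul, ← star_eq_conjTranspose,
      mem_unitaryGroup_iff'.1 U.2, vecMul_one]
  rw [← hsum, ← hsum] at h
  exact_mod_cast h

theorem measurePreserving_mulVec_gaussianWeight {n : ℕ} (U : unitaryGroup (Fin n) ℂ) :
    MeasurePreserving (fun z ↦ U.1 *ᵥ z)
      (gaussianWeight (Fin n)) (gaussianWeight (Fin n)) := by
  let f : (Fin n → ℂ) ≃ₗ[ℝ] (Fin n → ℂ) :=
    (UnitaryGroup.toLinearEquiv U).restrictScalars ℝ
  have hf : ⇑f = fun z ↦ U.1 *ᵥ z := rfl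
  have hmeas : Measurable f := f.toLinearMap.continuous_of_finiteDimensional.measurable
  obtain ⟨c, hc⟩ : ∃ c : ENNReal, Measure.map f volume = c • volume :=
    ⟨_, Measure.map_linearMap_addHaar_eq_smul_addHaar volume f.isUnit_det'.ne_zero⟩
  have hmap : (gaussianWeight (Fin n)).map f = c • gaussianWeight (Fin n) := by
    ext s hs
    rw [Measure.map_apply hmeas hs, Measure.smul_apply, gaussianWeight,
      withDensity_apply _ (hmeas hs), withDensity_apply _ hs, ← lintegral_smul_measure,
      ← Measure.restrict_smul, ← hc, setLIntegral_map hs (by fun_prop) hmeas]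
    refine lintegral_congr fun z ↦ ?_
    rw [hf, sum_norm_sq_mulVec]
  -- comparing total masses forces the Jacobian factor to be `1`
  have hc1 : c = 1 := by
    have h := congrArg (fun ν ↦ ν Set.univ) hmap
    simp only [Measure.map_apply hmeas MeasurableSet.univ, Set.preimage_univ, Measure.smul_apply,
      smul_eq_mul, gaussianWeight_univ] at h
    refine (ENNReal.mul_left_inj (c := ENNReal.ofReal (Real.pi ^ n)) ?_ ENNReal.ofReal_ne_top).1 ?_
    · exact (ENNReal.ofReal_pos.2 (by positivity)).ne'
    · rw [← h, one_mul]
  refine ⟨hf ▸ hmeas, ?_⟩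
  rw [← hf, hmap, hc1, one_smul]

/-- Every nonzero vector is a positive multiple of the `i`-th column of a unitary matrix. -/
theorem exists_unitary_column_eq {ι : Type*} [Fintype ι] [DecidableEq ι] (i : ι) {z : ι → ℂ}
    (hz : z ≠ 0) :
    ∃ (V : unitaryGroup ι ℂ) (r : ℝ), 0 < r ∧ ∀ j, z j = r * V.1 j i := by
  let x : EuclideanSpace ℂ ι := WithLp.toLp 2 z
  have hx : x ≠ 0 := fun h ↦ hz (congrArg WithLp.ofLp h)
  have hx' : ‖x‖ ≠ 0 := norm_ne_zero_iff.2 hx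
  let u : ι → EuclideanSpace ℂ ι := fun _ ↦ (‖x‖⁻¹ : ℂ) • x
  have hu : Orthonormal ℂ (({i} : Set ι).domRestrict u) := by
    rw [orthonormal_iff_ite]
    rintro ⟨a, rfl⟩ ⟨b, rfl⟩
    simp [u, inner_self_eq_norm_sq_to_K, norm_smul, hx']
  obtain ⟨b, hb⟩ := hu.exists_orthonormalBasis_extension_of_card_eq (ι := ι) (by simp)
  refine ⟨⟨_, (EuclideanSpace.basisFun ι ℂ).toMatrix_orthonormalBasis_mem_unitary b⟩, ‖x‖,
    norm_pos_iff.2 hx, fun j ↦ ?_⟩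
  have : (b i) j = (‖x‖⁻¹ : ℂ) * z j := by rw [hb i rfl]; simp [u, x]
  simp [Module.Basis.toMatrix_apply, this, hx']

/-! ### The tail of the modulus of a diagonal entry -/

section HaarEntry

variable {n : ℕ} [MeasurableSpace (unitaryGroup (Fin (n + 1)) ℂ)]
  [BorelSpace (unitaryGroup (Fin (n + 1)) ℂ)]
  (μ : Measure (unitaryGroup (Fin (n + 1)) ℂ)) [μ.IsHaarMeasure] [IsProbabilityMeasure μ]

/-- For a Haar matrix `G`, the law of `(G z)_i / ‖z‖` does not depend on `z ≠ 0`, so it is that of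
`G_ii`. -/
theorem haar_setOf_lt_norm_sq_mulVec (i : Fin (n + 1)) (t : ℝ) {z : Fin (n + 1) → ℂ} (hz : z ≠ 0) :
    μ {G | t * ∑ j, ‖z j‖ ^ 2 < ‖(G.1 *ᵥ z) i‖ ^ 2} =
      μ {G | t < ‖G.1 i i‖ ^ 2} := by
  have := isMulRightInvariant_of_isHaarMeasure μ
  obtain ⟨V, r, hr, hV⟩ := exists_unitary_column_eq i hz
  rw [← measure_preimage_mul_right μ V {G | t < ‖G.1 i i‖ ^ 2}]
  congr 1
  ext G
  have hentry : (G.1 *ᵥ z) i = r * (G * V).1 i i := by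
    simp only [mulVec, dotProduct, hV, Submonoid.coe_mul, mul_apply, Finset.mul_sum]
    exact Finset.sum_congr rfl fun j _ ↦ by ring
  have hnorm : ∑ j, ‖z j‖ ^ 2 = r ^ 2 := by
    have h1 : ∑ j, ‖V.1 j i‖ ^ 2 = 1 := by
      have := sum_norm_sq_mulVec V (Pi.single i 1)
      simpa [Pi.single_apply, apply_ite, ite_pow] using this
    simp_rw [hV, norm_mul, mul_pow, ← Finset.mul_sum, h1]
    simp
  simp only [Set.mem_ofPred_eq, Set.mem_preimage, hentry, hnorm, norm_mul, mul_pow,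
    Complex.norm_real, Real.norm_eq_abs, sq_abs]
  rw [mul_comm t, mul_lt_mul_iff_right₀ (by positivity)]

theorem haar_setOf_lt_norm_sq_entry (i : Fin (n + 1)) {t : ℝ} (ht0 : 0 ≤ t) (ht1 : t < 1) :
    μ {G | t < ‖G.1 i i‖ ^ 2} = ENNReal.ofReal ((1 - t) ^ n) := by
  have : SFinite (gaussianWeight (Fin (n + 1))) := by unfold gaussianWeight; infer_instance
  have hS : MeasurableSet {p : (Fin (n + 1) → ℂ) × unitaryGroup (Fin (n + 1)) ℂ |
      t * ∑ j, ‖p.1 j‖ ^ 2 < ‖(p.2.1 *ᵥ p.1) i‖ ^ 2} := by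
    simp only [mulVec, dotProduct]
    refine measurableSet_lt (by fun_prop) ?_
    have (j : Fin (n + 1)) : Measurable fun p : (Fin (n + 1) → ℂ) × unitaryGroup (Fin (n + 1)) ℂ ↦
        p.2.1 i j :=
      (measurable_unitaryGroup_entry i j).comp measurable_snd
    exact (Finset.measurable_fun_sum _ fun j _ ↦
      (this j).mul ((measurable_pi_apply j).comp measurable_fst)).norm.pow_const 2
  have hne : ∀ᵐ z ∂gaussianWeight (Fin (n + 1)), z ≠ 0 :=
    (withDensity_absolutelyContinuous _ _).ae_le
      (compl_mem_ae_iff.2 (measure_singleton 0))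
  -- both iterated integrals compute the mass of the set in `hS` under `gaussianWeight ⊗ μ`
  have h1 : (gaussianWeight (Fin (n + 1))).prod μ _ = _ := Measure.prod_apply hS
  rw [Measure.prod_apply_symm hS] at h1
  have h2 : ∫⁻ z, μ (Prod.mk z ⁻¹' {p : (Fin (n + 1) → ℂ) × unitaryGroup (Fin (n + 1)) ℂ |
      t * ∑ j, ‖p.1 j‖ ^ 2 < ‖(p.2.1 *ᵥ p.1) i‖ ^ 2})
        ∂gaussianWeight (Fin (n + 1)) =
      μ {G | t < ‖G.1 i i‖ ^ 2} * gaussianWeight (Fin (n + 1)) Set.univ := by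
    rw [← lintegral_const]
    refine lintegral_congr_ae ?_
    filter_upwards [hne] with z hz using haar_setOf_lt_norm_sq_mulVec μ i t hz
  have h3 (G : unitaryGroup (Fin (n + 1)) ℂ) :
      gaussianWeight (Fin (n + 1)) ((fun z ↦ (z, G)) ⁻¹'
        {p : (Fin (n + 1) → ℂ) × unitaryGroup (Fin (n + 1)) ℂ |
        t * ∑ j, ‖p.1 j‖ ^ 2 < ‖(p.2.1 *ᵥ p.1) i‖ ^ 2}) =
      ENNReal.ofReal ((1 - t) ^ n) * gaussianWeight (Fin (n + 1)) Set.univ := by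
    rw [← gaussianWeight_setOf_lt_norm_sq i ht0 ht1,
      ← (measurePreserving_mulVec_gaussianWeight G).measure_preimage
        (measurableSet_lt (by fun_prop) (by fun_prop)).nullMeasurableSet]
    congr 1
    ext z
    simp only [Set.mem_preimage, Set.mem_ofPred_eq, sum_norm_sq_mulVec]
  simp_rw [h3] at h1
  rw [h2, lintegral_const, measure_univ (μ := μ), mul_one, gaussianWeight_univ] at h1
  exact ((ENNReal.mul_left_inj (ENNReal.ofReal_pos.2 (by positivity)).ne'
    ENNReal.ofReal_ne_top).1 h1).symm

end HaarEntry

end UnitaryInvariance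

/-! ### The beta law and the uniform angle -/

section EntryLaw

open Set

instance (j : ℕ) : IsProbabilityMeasure (betaOneLaw j) := by
  unfold betaOneLaw
  split_ifs with h
  · infer_instance
  · exact isProbabilityMeasureBeta one_pos (by positivity)

theorem betaOneLaw_Ioi_of_lt_one (n : ℕ) {t : ℝ} (ht0 : 0 ≤ t) (ht1 : t < 1) :
    betaOneLaw n (Ioi t) = ENNReal.ofReal ((1 - t) ^ n) := by
  unfold betaOneLaw
  split_ifs with h
  · simp [h, ht1]
  · obtain ⟨m, rfl⟩ := Nat.exists_eq_succ_of_ne_zero h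
    have hbeta : 1 / beta 1 ((m.succ : ℕ) : ℝ) = m + 1 := by
      have hm : (m.succ : ℝ) = m + 1 := by push_cast; rfl
      have hG := Real.Gamma_add_one (s := (m : ℝ) + 1) (by positivity)
      have hpos : 0 < Real.Gamma ((m : ℝ) + 1) := Real.Gamma_pos_of_pos (by positivity)
      rw [beta, Real.Gamma_one, hm, add_comm (1 : ℝ) ((m : ℝ) + 1), hG]
      field_simp
    have hpdf : ∀ x ∈ Ioi t, betaPDF 1 ((m.succ : ℕ) : ℝ) x =
        (Iio 1).indicator (fun x ↦ ENNReal.ofReal ((m + 1) * (1 - x) ^ m)) x := by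
      intro x hx
      rw [betaPDF_eq, hbeta]
      by_cases hx1 : x < 1
      · rw [if_pos ⟨ht0.trans_lt hx, hx1⟩, indicator_of_mem (mem_Iio.2 hx1)]
        simp
      · rw [if_neg (fun h ↦ hx1 h.2), indicator_of_notMem (by simpa using hx1), ENNReal.ofReal_zero]
    have hderiv (x : ℝ) :
        HasDerivAt (fun x : ℝ ↦ -(1 - x) ^ (m + 1)) ((m + 1) * (1 - x) ^ m) x := by
      have := (((hasDerivAt_id x).const_sub 1).pow (m + 1)).neg
      refine this.congr_deriv ?_
      simp
    have hint : IntervalIntegrable (fun x : ℝ ↦ ((m : ℝ) + 1) * (1 - x) ^ m) volume t 1 :=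
      (by fun_prop : Continuous _).intervalIntegrable _ _
    rw [betaMeasure, withDensity_apply _ measurableSet_Ioi,
      setLIntegral_congr_fun measurableSet_Ioi hpdf, lintegral_indicator measurableSet_Iio,
      Measure.restrict_restrict measurableSet_Iio, inter_comm, Ioi_inter_Iio,
      restrict_Ioo_eq_restrict_Ioc, ← ofReal_integral_eq_lintegral_ofReal
        ((intervalIntegrable_iff_integrableOn_Ioc_of_le ht1.le).1 hint),
      ← intervalIntegral.integral_of_le ht1.le,
      intervalIntegral.integral_eq_sub_of_hasDerivAt (fun x _ ↦ hderiv x) hint]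
    · simp
    · refine (ae_restrict_iff' measurableSet_Ioc).2 (.of_forall fun x hx ↦ ?_)
      have : 0 ≤ 1 - x := sub_nonneg.2 hx.2
      positivity

theorem betaOneLaw_Ioi_one (n : ℕ) : betaOneLaw n (Ioi 1) = 0 := by
  unfold betaOneLaw
  split_ifs with h
  · simp
  · rw [betaMeasure, withDensity_apply _ measurableSet_Ioi]
    exact setLIntegral_eq_zero measurableSet_Ioi fun x hx ↦ betaPDF_eq_zero_of_one_le hx.out.le

/-- The hypothesis `h1` matters only for `n = 0`, where the tail does not vanish as `t` tends to
`1`. -/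
theorem eq_betaOneLaw_of_Ioi {ν : Measure ℝ} [IsProbabilityMeasure ν] {n : ℕ}
    (h : ∀ t, 0 ≤ t → t < 1 → ν (Ioi t) = ENNReal.ofReal ((1 - t) ^ n)) (h1 : ν (Ioi 1) = 0) :
    ν = betaOneLaw n := by
  have hneg {ρ : Measure ℝ} [IsProbabilityMeasure ρ]
      (hρ : ∀ t, 0 ≤ t → t < 1 → ρ (Ioi t) = ENNReal.ofReal ((1 - t) ^ n)) {t : ℝ} (ht : t < 0) :
      ρ (Ioi t) = 1 := by
    refine le_antisymm prob_le_one ?_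
    calc (1 : ENNReal) = ρ (Ioi 0) := by simp [hρ 0 le_rfl one_pos]
      _ ≤ ρ (Ioi t) := measure_mono (Ioi_subset_Ioi ht.le)
  have hIoi (t : ℝ) : ν (Ioi t) = betaOneLaw n (Ioi t) := by
    rcases lt_or_ge t 0 with ht0 | ht0
    · rw [hneg h ht0, hneg (fun _ ↦ betaOneLaw_Ioi_of_lt_one n) ht0]
    rcases lt_or_ge t 1 with ht1 | ht1
    · rw [h t ht0 ht1, betaOneLaw_Ioi_of_lt_one n ht0 ht1]
    · rw [measure_mono_null (Ioi_subset_Ioi ht1) h1,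
        measure_mono_null (Ioi_subset_Ioi ht1) (betaOneLaw_Ioi_one n)]
  refine Measure.ext_of_Iic _ _ fun t ↦ ?_
  rw [← compl_Ioi, prob_compl_eq_one_sub measurableSet_Ioi, prob_compl_eq_one_sub measurableSet_Ioi,
    hIoi]

/-- The uniform distribution on `(0, 2π)`. -/
noncomputable def uniformAngle : Measure ℝ :=
  ProbabilityTheory.cond volume (Ioo 0 (2 * Real.pi))

instance : IsProbabilityMeasure uniformAngle :=
  cond_isProbabilityMeasure_of_finite (by simp [Real.pi_pos]) measure_Ioo_lt_top.ne

/-- The uniform angle is shift invariant modulo `2π`. -/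
theorem lintegral_uniformAngle_add {f : ℝ → ENNReal}
    (hf : Function.Periodic f (2 * Real.pi)) (φ : ℝ) :
    ∫⁻ θ, f (θ + φ) ∂uniformAngle = ∫⁻ θ, f θ ∂uniformAngle := by
  unfold uniformAngle ProbabilityTheory.cond
  rw [lintegral_smul_measure, lintegral_smul_measure, restrict_Ioo_eq_restrict_Ioc]
  congr 1
  have hpre : Ioc 0 (2 * Real.pi) = (· + φ) ⁻¹' Ioc φ (φ + 2 * Real.pi) := by simp
  calc ∫⁻ θ in Ioc 0 (2 * Real.pi), f (θ + φ)
      = ∫⁻ θ in Ioc φ (φ + 2 * Real.pi), f θ := by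
        rw [hpre]
        exact (measurePreserving_add_right volume φ).setLIntegral_comp_preimage_emb
          (measurableEmbedding_addRight φ) _ _
    _ = ∫⁻ θ in Ioc 0 (0 + 2 * Real.pi), f θ := by
        refine (isAddFundamentalDomain_Ioc Real.two_pi_pos φ).setLIntegral_eq
          (isAddFundamentalDomain_Ioc Real.two_pi_pos 0) f ?_
        rintro ⟨_, k, rfl⟩ x
        rw [AddSubgroup.vadd_def, vadd_eq_add, add_comm]
        exact hf.zsmul k x
    _ = ∫⁻ θ in Ioc 0 (2 * Real.pi), f θ := by rw [zero_add]

/-- The map `(θ, b) ↦ 1 - e^{iθ} √b`. -/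
noncomputable def oneSubPolar (p : ℝ × ℝ) : ℂ :=
  1 - Complex.exp (Complex.I * p.1) * (√p.2 : ℂ)

@[fun_prop]
theorem measurable_oneSubPolar : Measurable oneSubPolar := by
  unfold oneSubPolar; fun_prop

/-- The law of `1 - e^{iθ} √β_{1,n}`, where `θ` is uniform on `(0, 2π)` and independent of
`β_{1,n}`. -/
noncomputable def factorLaw (n : ℕ) : Measure ℂ :=
  (uniformAngle.prod (betaOneLaw n)).map oneSubPolar

instance (n : ℕ) : IsProbabilityMeasure (factorLaw n) :=
  Measure.isProbabilityMeasure_map (by fun_prop)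

/-! ### Diagonal entries in polar form -/

section HaarEntryLaw

open Matrix

variable {n : ℕ} [MeasurableSpace (unitaryGroup (Fin (n + 1)) ℂ)]
  [BorelSpace (unitaryGroup (Fin (n + 1)) ℂ)]
  (μ : Measure (unitaryGroup (Fin (n + 1)) ℂ)) [μ.IsHaarMeasure]

theorem haar_map_norm_sq_entry [IsProbabilityMeasure μ] (i : Fin (n + 1)) :
    μ.map (fun G ↦ ‖G.1 i i‖ ^ 2) = betaOneLaw n := by
  have hmeas : Measurable fun G : unitaryGroup (Fin (n + 1)) ℂ ↦ ‖G.1 i i‖ ^ 2 := by fun_prop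
  have : IsProbabilityMeasure (μ.map fun G ↦ ‖G.1 i i‖ ^ 2) :=
    Measure.isProbabilityMeasure_map hmeas.aemeasurable
  refine eq_betaOneLaw_of_Ioi (fun t ht0 ht1 ↦ ?_) ?_
  · rw [Measure.map_apply hmeas measurableSet_Ioi]
    exact haar_setOf_lt_norm_sq_entry μ i ht0 ht1
  · rw [Measure.map_apply hmeas measurableSet_Ioi]
    convert! measure_empty (μ := μ)
    refine eq_empty_of_forall_notMem fun G hG ↦ ?_
    have h1 : ‖G.1 i i‖ ≤ 1 := entry_norm_bound_of_unitary G.2 i i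
    exact absurd (mem_Ioi.1 hG) (not_lt.2 (pow_le_one₀ (norm_nonneg _) h1))

/-- The law of an entry is rotation invariant, since scalar matrices of modulus one are unitary. -/
theorem haar_lintegral_exp_mul_entry (i : Fin (n + 1)) (f : ℂ → ENNReal) (θ : ℝ) :
    ∫⁻ G, f (Complex.exp (Complex.I * θ) * G.1 i i) ∂μ = ∫⁻ G, f (G.1 i i) ∂μ := by
  have hmem : Complex.exp (Complex.I * θ) • (1 : Matrix (Fin (n + 1)) (Fin (n + 1)) ℂ) ∈
      unitaryGroup (Fin (n + 1)) ℂ := by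
    rw [mem_unitaryGroup_iff, star_smul, star_one, smul_mul_smul_comm, mul_one,
      Complex.star_def, Complex.mul_conj', mul_comm Complex.I, Complex.norm_exp_ofReal_mul_I]
    simp
  rw [← lintegral_mul_left_eq_self (fun G : unitaryGroup (Fin (n + 1)) ℂ ↦ f (G.1 i i)) ⟨_, hmem⟩]
  simp

/-- A diagonal entry of a Haar matrix of `U(n+1)` has the law of `e^{iθ} √β_{1,n}`. -/
theorem haar_map_one_sub_entry [IsProbabilityMeasure μ] (i : Fin (n + 1)) :
    μ.map (fun G ↦ 1 - G.1 i i) = factorLaw n := by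
  have hX : Measurable fun G : unitaryGroup (Fin (n + 1)) ℂ ↦ G.1 i i := by fun_prop
  refine Measure.ext_of_lintegral _ fun f hf ↦ ?_
  have hjoint : Measurable fun p : unitaryGroup (Fin (n + 1)) ℂ × ℝ ↦
      f (1 - Complex.exp (Complex.I * p.2) * p.1.1 i i) :=
    hf.comp (measurable_const.sub (Measurable.mul (by fun_prop) (hX.comp measurable_fst)))
  rw [factorLaw, lintegral_map hf (by fun_prop), lintegral_map hf measurable_oneSubPolar,
    ← haar_map_norm_sq_entry μ i, lintegral_prod_symm _ (by fun_prop),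
    lintegral_map (f := fun y ↦ ∫⁻ θ, f (oneSubPolar (θ, y)) ∂uniformAngle)
      ((hf.comp measurable_oneSubPolar).lintegral_prod_left') (by fun_prop)]
  calc ∫⁻ G, f (1 - G.1 i i) ∂μ
      = ∫⁻ θ, ∫⁻ G, f (1 - Complex.exp (Complex.I * θ) * G.1 i i) ∂μ ∂uniformAngle := by
        have h (θ : ℝ) := haar_lintegral_exp_mul_entry μ i (fun z ↦ f (1 - z)) θ
        simp_rw [h]
        simp
    _ = ∫⁻ G, ∫⁻ θ, f (1 - Complex.exp (Complex.I * θ) * G.1 i i) ∂uniformAngle ∂μ :=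
        (lintegral_lintegral_swap hjoint.aemeasurable).symm
    _ = ∫⁻ G, ∫⁻ θ, f (oneSubPolar (θ, ‖G.1 i i‖ ^ 2)) ∂uniformAngle ∂μ := by
        refine lintegral_congr fun G ↦ ?_
        have hper : Function.Periodic
            (fun θ : ℝ ↦ f (oneSubPolar (θ, ‖G.1 i i‖ ^ 2))) (2 * Real.pi) := by
          intro θ
          simp only [oneSubPolar]
          congr 3
          push_cast
          rw [mul_comm, mul_comm Complex.I]
          exact Complex.exp_mul_I_periodic _
        -- shifting `θ` by the argument of the entry absorbs its phase
        rw [← lintegral_uniformAngle_add hper (G.1 i i).arg]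
        refine lintegral_congr fun θ ↦ ?_
        simp only [oneSubPolar, Real.sqrt_sq (norm_nonneg _)]
        nth_rewrite 1 [← Complex.norm_mul_exp_arg_mul_I (G.1 i i)]
        rw [Complex.ofReal_add, mul_add, Complex.exp_add,
          mul_comm Complex.I (Complex.ofReal (G.1 i i).arg)]
        congr 2
        ring

end HaarEntryLaw

end EntryLaw

/-! ### The recursion on the size of the matrix -/

section Recursion

open Matrix

variable {n : ℕ} (e : Unit ⊕ Fin n ≃ Fin (n + 1))

theorem reindex_fromBlocks_mem_unitaryGroup (H : unitaryGroup (Fin n) ℂ) :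
    reindex e e (fromBlocks 1 0 0 H.1) ∈ unitaryGroup (Fin (n + 1)) ℂ := by
  rw [mem_unitaryGroup_iff', star_eq_conjTranspose, conjTranspose_reindex, reindex_apply,
    reindex_apply, submatrix_mul_equiv, fromBlocks_conjTranspose, fromBlocks_multiply]
  have : (H.1)ᴴ * H.1 = 1 := mem_unitaryGroup_iff'.1 H.2
  simp [this]

theorem exists_unitary_det_one_sub_mul_reindex (G : unitaryGroup (Fin (n + 1)) ℂ) :
    ∃ K : unitaryGroup (Fin n) ℂ, ∀ H : unitaryGroup (Fin n) ℂ,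
      det (1 - G.1 * reindex e e (fromBlocks 1 0 0 H.1)) =
        (1 - G.1 (e (.inl ())) (e (.inl ()))) * det (1 - (K * H).1) := by
  set A := G.1.submatrix e e with hA
  have hAmem : A ∈ unitaryGroup (Unit ⊕ Fin n) ℂ := by
    rw [mem_unitaryGroup_iff', star_eq_conjTranspose, hA, conjTranspose_submatrix,
      submatrix_mul_equiv, ← star_eq_conjTranspose, mem_unitaryGroup_iff'.1 G.2,
      submatrix_one_equiv]
  rw [← fromBlocks_toBlocks A] at hAmem
  obtain ⟨K, hK, hdet⟩ := exists_unitary_schurComplement hAmem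
  refine ⟨⟨K, hK⟩, fun H ↦ ?_⟩
  have h := hdet H.1
  rw [fromBlocks_toBlocks] at h
  have hG : G.1 = A.submatrix e.symm e.symm := by simp [hA]
  rw [reindex_apply, hG, submatrix_mul_equiv, ← submatrix_one_equiv e.symm]
  change det ((1 - A * fromBlocks 1 0 0 H.1).submatrix e.symm e.symm) = _
  rw [det_submatrix_equiv_self, h]
  simp [hA, toBlocks₁₁]

theorem measurable_det_one_sub {ι : Type*} [Fintype ι] [DecidableEq ι]
    [MeasurableSpace (unitaryGroup ι ℂ)] [BorelSpace (unitaryGroup ι ℂ)] :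
    Measurable fun G : unitaryGroup ι ℂ ↦ det (1 - G.1) :=
  measurable_det_of_entries fun i j ↦ (measurable_unitaryGroup_entry i j).const_sub _

/-- `det (1 - G)`, with `G` Haar on `U(n+1)`, is distributed as `(1 - G_ii) det (1 - H)` with `H`
Haar on `U(n)` and independent of `G`. -/
theorem haar_map_det_one_sub_succ [MeasurableSpace (unitaryGroup (Fin (n + 1)) ℂ)]
    [BorelSpace (unitaryGroup (Fin (n + 1)) ℂ)] [MeasurableSpace (unitaryGroup (Fin n) ℂ)]
    [BorelSpace (unitaryGroup (Fin n) ℂ)]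
    (μ : Measure (unitaryGroup (Fin (n + 1)) ℂ)) [μ.IsHaarMeasure] [IsProbabilityMeasure μ]
    (ν : Measure (unitaryGroup (Fin n) ℂ)) [ν.IsHaarMeasure] [IsProbabilityMeasure ν] :
    μ.map (fun G ↦ det (1 - G.1)) = factorLaw n ∗ₘ ν.map (fun H ↦ det (1 - H.1)) := by
  have e : Unit ⊕ Fin n ≃ Fin (n + 1) := Fintype.equivOfCardEq (by simp [add_comm])
  have := isMulRightInvariant_of_isHaarMeasure μ
  let i := e (.inl ())
  have hentry : Measurable fun G : unitaryGroup (Fin (n + 1)) ℂ ↦ 1 - G.1 i i :=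
    (measurable_unitaryGroup_entry i i).const_sub 1
  refine Measure.ext_of_lintegral _ fun f hf ↦ ?_
  have hjoint : Measurable fun p : unitaryGroup (Fin n) ℂ × unitaryGroup (Fin (n + 1)) ℂ ↦
      f (det (1 - p.2.1 * reindex e e (fromBlocks 1 0 0 p.1.1))) := by
    refine hf.comp (measurable_det_of_entries fun a b ↦ ?_)
    simp only [Matrix.sub_apply, mul_apply, reindex_apply, submatrix_apply]
    refine (Finset.measurable_fun_sum _ fun c _ ↦ Measurable.mul
      ((measurable_unitaryGroup_entry a c).comp measurable_snd) ?_).const_sub _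
    rcases e.symm c with x | x <;> rcases e.symm b with y | y
    · exact measurable_const
    · exact measurable_const
    · exact measurable_const
    · exact (measurable_unitaryGroup_entry x y).comp measurable_fst
  rw [← haar_map_one_sub_entry μ i, Measure.lintegral_mconv hf,
    lintegral_map hf measurable_det_one_sub,
    lintegral_map (Measurable.lintegral_prod_right (by fun_prop)) hentry]
  calc ∫⁻ G, f (det (1 - G.1)) ∂μ
      = ∫⁻ H, ∫⁻ G, f (det (1 - G.1 * reindex e e (fromBlocks 1 0 0 H.1))) ∂μ ∂ν := by
        have h (H : unitaryGroup (Fin n) ℂ) := lintegral_mul_right_eq_self (μ := μ)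
          (fun G ↦ f (det (1 - G.1))) ⟨_, reindex_fromBlocks_mem_unitaryGroup e H⟩
        simp only [Submonoid.coe_mul] at h
        simp_rw [h]
        simp
    _ = ∫⁻ G, ∫⁻ H, f (det (1 - G.1 * reindex e e (fromBlocks 1 0 0 H.1))) ∂ν ∂μ :=
        lintegral_lintegral_swap hjoint.aemeasurable
    _ = ∫⁻ G, ∫⁻ z, f ((1 - G.1 i i) * z) ∂(ν.map fun H ↦ det (1 - H.1)) ∂μ := by
        refine lintegral_congr fun G ↦ ?_
        obtain ⟨K, hK⟩ := exists_unitary_det_one_sub_mul_reindex e G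
        simp_rw [hK]
        rw [lintegral_mul_left_eq_self (fun H ↦ f ((1 - G.1 i i) * det (1 - H.1))) K,
          lintegral_map (by fun_prop) measurable_det_one_sub]

end Recursion

/-- The law of `∏_{k < n} (1 - e^{iθ_k} √β_{1,k})` with all variables independent, as an iterated
multiplicative convolution. -/
noncomputable def factorProductLaw : ℕ → Measure ℂ
  | 0 => Measure.dirac 1
  | n + 1 => factorLaw n ∗ₘ factorProductLaw n

instance (n : ℕ) : IsProbabilityMeasure (factorProductLaw n) := by
  induction n with
  | zero => unfold factorProductLaw; infer_instance
  | succ n ih => unfold factorProductLaw; infer_instance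

theorem haar_map_det_one_sub (N : ℕ) :
    ∀ [MeasurableSpace (Matrix.unitaryGroup (Fin N) ℂ)]
      [BorelSpace (Matrix.unitaryGroup (Fin N) ℂ)] (μ : Measure (Matrix.unitaryGroup (Fin N) ℂ))
      [μ.IsHaarMeasure] [IsProbabilityMeasure μ],
      μ.map (fun G ↦ Matrix.det (1 - G.1)) = factorProductLaw N := by
  induction N with
  | zero =>
    intro _ _ μ _ _
    simp [factorProductLaw, Measure.map_const]
  | succ n ih =>
    intro _ _ μ _ _
    borelize ↥(Matrix.unitaryGroup (Fin n) ℂ)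
    obtain ⟨ν, _, _⟩ := exists_isHaarMeasure_isProbabilityMeasure (Matrix.unitaryGroup (Fin n) ℂ)
    rw [haar_map_det_one_sub_succ μ ν, ih ν, factorProductLaw]

/-! ### The product of independent factors -/

theorem hasLaw_prod_oneSubPolar {Ω : Type*} [MeasurableSpace Ω] {P : Measure Ω}
    [IsProbabilityMeasure P] {N : ℕ} {θ β : Fin N → Ω → ℝ}
    (hθ : ∀ k, HasLaw (θ k) uniformAngle P) (hβ : ∀ k : Fin N, HasLaw (β k) (betaOneLaw k) P)
    (hind : iIndepFun (Sum.elim θ β) P) :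
    HasLaw (fun ω ↦ ∏ k, oneSubPolar (θ k ω, β k ω)) (factorProductLaw N) P := by
  induction N with
  | zero =>
    simpa [factorProductLaw] using
      hasLaw_dirac_of_ae_eq (P := P) (x := (1 : ℂ)) (ae_eq_refl _)
  | succ n ih =>
    have hprefix := ih (θ := fun k ↦ θ k.castSucc) (β := fun k ↦ β k.castSucc)
      (fun k ↦ hθ _) (fun k ↦ hβ _) (by
        have := hind.precomp (g := Sum.map Fin.castSucc Fin.castSucc)
          (Sum.map_injective.2 ⟨Fin.castSucc_injective n, Fin.castSucc_injective n⟩)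
        convert! this using 1
        ext (k | k) <;> rfl)
    have hpair : HasLaw (fun ω ↦ (θ (Fin.last n) ω, β (Fin.last n) ω))
        (uniformAngle.prod (betaOneLaw n)) P :=
      IndepFun.hasLaw_prod (hθ _) (hβ _)
        (hind.indepFun (i := .inl (Fin.last n)) (j := .inr (Fin.last n)) (by simp))
    have hlast : HasLaw (fun ω ↦ oneSubPolar (θ (Fin.last n) ω, β (Fin.last n) ω))
        (factorLaw n) P :=
      HasLaw.fun_comp ⟨measurable_oneSubPolar.aemeasurable, rfl⟩ hpair
    have hmeas : ∀ i, AEMeasurable (Sum.elim θ β i) P := by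
      rintro (k | k)
      exacts [(hθ k).aemeasurable, (hβ k).aemeasurable]
    -- `T` collects the indices of the last angle and of the last beta variable
    let T : Finset (Fin (n + 1) ⊕ Fin (n + 1)) := {.inl (Fin.last n), .inr (Fin.last n)}
    have hl (k : Fin n) : Sum.inl k.castSucc ∈ Tᶜ := by simp [T, (Fin.castSucc_lt_last k).ne]
    have hr (k : Fin n) : Sum.inr k.castSucc ∈ Tᶜ := by simp [T, (Fin.castSucc_lt_last k).ne]
    have hindep : IndepFun (fun ω ↦ oneSubPolar (θ (Fin.last n) ω, β (Fin.last n) ω))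
        (fun ω ↦ ∏ k : Fin n, oneSubPolar (θ k.castSucc ω, β k.castSucc ω)) P := by
      have h := hind.indepFun_finset₀ T Tᶜ disjoint_compl_right hmeas
      have hφ : Measurable fun v : T → ℝ ↦ oneSubPolar (v ⟨.inl (Fin.last n), by simp [T]⟩,
          v ⟨.inr (Fin.last n), by simp [T]⟩) :=
        measurable_oneSubPolar.comp ((measurable_pi_apply _).prodMk (measurable_pi_apply _))
      have hψ : Measurable fun v : ↥Tᶜ → ℝ ↦ ∏ k : Fin n,
          oneSubPolar (v ⟨.inl k.castSucc, hl k⟩, v ⟨.inr k.castSucc, hr k⟩) :=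
        Finset.measurable_fun_prod _ fun k _ ↦
          measurable_oneSubPolar.comp ((measurable_pi_apply _).prodMk (measurable_pi_apply _))
      exact h.comp hφ hψ
    rw [factorProductLaw]
    simp_rw [Fin.prod_univ_castSucc, mul_comm _ (oneSubPolar (θ (Fin.last n) _, _))]
    exact hindep.hasLaw_fun_mul hlast hprefix

theorem mainTheorem3 (N : ℕ)
    [MeasurableSpace (Matrix.unitaryGroup (Fin N) ℂ)] [BorelSpace (Matrix.unitaryGroup (Fin N) ℂ)]
    (μ : Measure (Matrix.unitaryGroup (Fin N) ℂ)) [μ.IsHaarMeasure] [IsProbabilityMeasure μ]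
    {Ω : Type*} [MeasurableSpace Ω] (P : Measure Ω) [IsProbabilityMeasure P]
    (G : Ω → Matrix.unitaryGroup (Fin N) ℂ) (hG : HasLaw G μ P)
    {Ω' : Type*} [MeasurableSpace Ω'] (P' : Measure Ω') [IsProbabilityMeasure P']
    (θ β : Fin N → Ω' → ℝ)
    (hθ : ∀ k, pdf.IsUniform (θ k) (Set.Ioo 0 (2 * Real.pi)) P' volume)
    (hβ : ∀ k : Fin N, HasLaw (β k) (betaOneLaw k) P')
    (hind : iIndepFun (Sum.elim θ β) P') :
    IdentDistrib
      (fun ω => Matrix.det (1 - (G ω : Matrix (Fin N) (Fin N) ℂ)))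
      (fun ω' => ∏ k : Fin N,
        (1 - Complex.exp (Complex.I * (θ k ω' : ℂ)) * (Real.sqrt (β k ω') : ℂ)))
      P P' := by
  have hdet : HasLaw (fun ω ↦ Matrix.det (1 - (G ω).1)) (factorProductLaw N) P :=
    HasLaw.fun_comp (Y := fun G ↦ Matrix.det (1 - G.1))
      ⟨measurable_det_one_sub.aemeasurable, haar_map_det_one_sub N μ⟩ hG
  have hθ' (k : Fin N) : HasLaw (θ k) uniformAngle P' :=
    ⟨(hθ k).aemeasurable (by simp [Real.pi_pos]) measure_Ioo_lt_top.ne, hθ k⟩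
  have hprod := hasLaw_prod_oneSubPolar hθ' hβ hind
  exact ⟨hdet.aemeasurable, hprod.aemeasurable, hdet.map_eq.trans hprod.map_eq.symm⟩
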